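/- Let $d\ge 1$, let $\Omega\subset\mathbb{R}^d$ be a bounded open set, let $\kappa:\Omega\to\mathbb{R}$ be measurable with $0<\kappa_0\le\kappa\le\kappa_1$ a.e., and let $b\in L^\infty(\Omega)^d$ be divergence free in the sense of distributions. Put $V=H^1_0(\Omega)$ and $$a(u,v)=\int_\Omega\big(\kappa\nabla u\cdot\nabla v+v\,b\cdot\nabla u\big),\qquad a^*(u,v)=a(v,u).$$ Coarse grid. Let $\overline\Omega=K_1\cup\dots\cup K_N$, where the coarse elements $K_i$ are compact sets with $K_i=\overline{\operatorname{int}K_i}$, $\operatorname{int}K_i\subset\Omega$, boundaries of measure zero and pairwise disjoint interiors (for instance the elements of a conforming finite element mesh). Let $x_1,\dots,x_{N_c}\in\overline\Omega$ be the coarse nodes, let $\omega_j$ be the union of the $K_i$ that contain $x_j$, and let $\chi_1,\dots,\chi_{N_c}\ge 0$ be a partition of unity on $\overline\Omega$, each $\chi_j$ being Lipschitz on every $K_i$ and zero on every $K_i$ that does not contain $x_j$. Put $\tilde\kappa=\kappa\sum_j|\nabla\chi_j|$, $$s^{(i)}(u,v)=\int_{K_i}\kappa\nabla u\cdot\nabla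 v,\qquad c^{(i)}(u,v)=\int_{K_i}\big(\kappa^{-1}|b|^2uv+\tilde\kappa uv\big),$$ $s=\sum_is^{(i)}$, $c=\sum_ic^{(i)}$, $(u,v)_V=s(u,v)+c(u,v)$, $\|u\|_V=\sqrt{(u,u)_V}$, and $\|w\|_W=\sup_{0\ne v\in V}a(v,w)/\|v\|_V$ for $w\in V$. Auxiliary functions. For each $i$ let $\phi^{(i)}_1,\dots,\phi^{(i)}_{J_i}\in H^1(K_i)$ be the first $J_i$ eigenfunctions, in non-decreasing order of the eigenvalues and chosen $c^{(i)}$-orthogonal, of the problem $s^{(i)}(\phi,v)=\lambda\,c^{(i)}(\phi,v)$ for all $v\in H^1(K_i)$, where an eigenfunction satisfies $c^{(i)}(\phi,\phi)\neq0$. "First" means that every eigenfunction that is $c^{(i)}$-orthogonal to all of them has an eigenvalue at least as large as each of theirs. Extend these functions by zero and let $$\pi(u)=\sum_{i=1}^N\sum_{j=1}^{J_i}\frac{c^{(i)}(u,\phi^{(i)}_j)}{c^{(i)}(\phi^{(i)}_j,\phi^{(i)}_j)}\,\phi^{(i)}_j .$$ Trial and test spaces. For $1\le i\le N_c$ let $q_i\in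 V$ be supported in $\omega_i$, and let $V_{ms}=\operatorname{span}\{q_1,\dots,q_{N_c}\}$. Let $\psi^{(i)}_j\in V$ solve $$a^*(\psi^{(i)}_j,v)+c(\pi(\psi^{(i)}_j),v)=c(\phi^{(i)}_j,\pi(v))\quad\forall v\in V,$$ let $\xi_i\in H^1_0(\Omega\cap\operatorname{int}\omega_i)$, extended by zero, solve $a(v,\xi_i)=s(q_i,v)$ for all $v\in H^1_0(\Omega\cap\operatorname{int}\omega_i)$, and let $\eta_i\in V$ solve $$a^*(\eta_i,v)+c(\pi(\eta_i),\pi(v))=(q_i,v)_V-a(v,\xi_i)\quad\forall v\in V.$$ Put $W_{glo}=\operatorname{span}\{\psi^{(i)}_j:1\le i\le N,\ 1\le j\le J_i\}+\operatorname{span}\{\eta_i+\xi_i:1\le i\le N_c\}$. Then for every $v\in V_{ms}$ there is a unique $w\in W_{glo}$ such that $(u,v)_V=a(u,w)$ for all $u\in V$. Moreover, if $V_{ms}\ne\{0\}$, then $$\inf_{0\ne v\in V_{ms}}\ \sup_{0\ne z\in W_{glo}}\frac{a(v,z)}{\|v\|_V\|z\|_W}=1,$$ where the suprema (including those that define $\|\cdot\|_W$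 on $V$) and the infimum are finite. -/

import Mathlib

open MeasureTheory
open scoped ContDiff InnerProductSpace

noncomputable section

namespace MultiscaleStab

/-- Euclidean space `ℝ^d`. -/
abbrev E (d : ℕ) := EuclideanSpace ℝ (Fin d)

/-- Pairs `(u, g)` of a square integrable function and a square integrable vector field on `ℝ^d`.
A Sobolev function on an open set `U` is represented by the pair `(u, ∇u)`, both components being
extended by zero outside `U`. -/
abbrev L2Pair (d : ℕ) := WithLp 2 (Lp ℝ 2 (volume : Measure (E d)) × Lp (E d) 2 (volume : Measure (E d)))

variable {d : ℕ}

/-- The function component. -/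
def val (u : L2Pair d) : E d → ℝ := fun x => (u.fst : E d → ℝ) x

/-- The gradient component. -/
def grad (u : L2Pair d) : E d → E d := fun x => (u.snd : E d → E d) x

/-- Test functions on an open set `U`: smooth functions with compact support contained in `U`. -/
structure IsTestFunction (U : Set (E d)) (θ : E d → ℝ) : Prop where
  contDiff : ContDiff ℝ ∞ θ
  hasCompactSupport : HasCompactSupport θ
  tsupport_subset : tsupport θ ⊆ U

/-- `H¹(U)` for an open set `U`: pairs `(u, g)` in `L²`, zero outside `U`, such that `g` is the weak
gradient of `u` on `U`. -/
def H1 (U : Set (E d)) : Set (L2Pair d) :=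
  {u | (∀ᵐ x, x ∉ U → val u x = 0 ∧ grad u x = 0) ∧
    ∀ θ : E d → ℝ, IsTestFunction U θ → ∀ e : E d,
      ∫ x in U, val u x * fderiv ℝ θ x e = - ∫ x in U, ⟪grad u x, e⟫_ℝ * θ x}

/-- `H¹₀(U)` for an open set `U`: the closure, in the norm of `H¹`, of the test functions on `U`. -/
def H10 (U : Set (E d)) : Submodule ℝ (L2Pair d) :=
  (Submodule.span ℝ {u : L2Pair d | ∃ θ : E d → ℝ, IsTestFunction U θ ∧
    val u =ᵐ[volume] θ ∧ grad u =ᵐ[volume] gradient θ}).topologicalClosure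

/-- The coefficients of the convection-diffusion equation `-div (κ ∇u) + b · ∇u = f` on a domain
`Ω ⊆ ℝ^d`: a diffusion coefficient `κ` bounded above and below by positive constants and a bounded
velocity field `b` which is divergence free in the sense of distributions. -/
structure ConvectionDiffusion (d : ℕ) where
  Ω : Set (E d)
  κ : E d → ℝ
  b : E d → E d
  isOpen_domain : IsOpen Ω
  isBounded_domain : Bornology.IsBounded Ω
  κ_meas : AEStronglyMeasurable κ (volume.restrict Ω)
  b_meas : AEStronglyMeasurable b (volume.restrict Ω)
  κ_bounds : ∃ κ₀ κ₁ : ℝ, 0 < κ₀ ∧ ∀ᵐ x ∂(volume.restrict Ω), κ₀ ≤ κ x ∧ κ x ≤ κ₁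
  b_bounded : ∃ B : ℝ, ∀ᵐ x ∂(volume.restrict Ω), ‖b x‖ ≤ B
  b_divFree : ∀ θ : E d → ℝ, IsTestFunction Ω θ → ∫ x in Ω, ⟪b x, gradient θ x⟫_ℝ = 0

namespace ConvectionDiffusion

variable (P : ConvectionDiffusion d)

/-- The space `V = H¹₀(Ω)`. -/
def V : Submodule ℝ (L2Pair d) := H10 P.Ω

/-- The bilinear form `a(u, v) = ∫_Ω (κ ∇u · ∇v + v b · ∇u)`. -/
def a (u v : L2Pair d) : ℝ :=
  ∫ x in P.Ω, (P.κ x * ⟪grad u x, grad v x⟫_ℝ + val v x * ⟪P.b x, grad u x⟫_ℝ)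

/-- The adjoint form `a*(u, v) = a(v, u)`. -/
def aStar (u v : L2Pair d) : ℝ := P.a v u

end ConvectionDiffusion

/-- A coarse grid on the domain: finitely many compact elements `K i` with disjoint interiors and
null boundaries that cover the closed domain, finitely many nodes (vertices of elements), and a
partition of unity `χ j` indexed by the nodes, Lipschitz on each element, with `χ j` supported in
the union of the elements that contain the node `j`. Conforming partitions into triangles,
quadrilaterals, tetrahedra etc. with their vertices are of this kind; neither the shape of
the elements nor conformity is restricted further. -/
structure CoarseGrid (P : ConvectionDiffusion d) where
  N : ℕ
  Nc : ℕ
  K : Fin N → Set (E d)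
  node : Fin Nc → E d
  χ : Fin Nc → E d → ℝ
  isCompact_K : ∀ i, IsCompact (K i)
  closure_interior_K : ∀ i, closure (interior (K i)) = K i
  frontier_K : ∀ i, volume (frontier (K i)) = 0
  disjoint_interior : ∀ i k, i ≠ k → Disjoint (interior (K i)) (interior (K k))
  cover : ⋃ i, K i = closure P.Ω
  interior_subset : ∀ i, interior (K i) ⊆ P.Ω
  node_mem : ∀ j, ∃ i, node j ∈ K i
  χ_lipschitz : ∀ j i, ∃ L, LipschitzOnWith L (χ j) (K i)
  χ_nonneg : ∀ j, ∀ x ∈ closure P.Ω, 0 ≤ χ j x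
  χ_sum : ∀ x ∈ closure P.Ω, ∑ j, χ j x = 1
  χ_support : ∀ j i, node j ∉ K i → ∀ x ∈ K i, χ j x = 0

namespace CoarseGrid

variable {P : ConvectionDiffusion d} (G : CoarseGrid P)

/-- The coarse neighbourhood `ω_j`: the union of the elements that contain the node `j`. -/
def patch (j : Fin G.Nc) : Set (E d) := ⋃ i ∈ {i | G.node j ∈ G.K i}, G.K i

/-- `V₀(ω_j) = H¹₀(ω_j)`, on the open set of the points of `Ω` interior to `ω_j`. -/
def V0ω (j : Fin G.Nc) : Submodule ℝ (L2Pair d) := H10 (P.Ω ∩ interior (G.patch j))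

/-- The weight `κ̃ = κ ∑_j |∇χ_j|`. -/
def κt (x : E d) : ℝ := P.κ x * ∑ j, ‖gradient (G.χ j) x‖

/-- `s⁽ⁱ⁾(u, v) = ∫_{K_i} κ ∇u · ∇v`. -/
def sLoc (i : Fin G.N) (u v : L2Pair d) : ℝ :=
  ∫ x in G.K i, P.κ x * ⟪grad u x, grad v x⟫_ℝ

/-- `c⁽ⁱ⁾(u, v) = ∫_{K_i} (κ⁻¹ |b|² u v + κ̃ u v)`. -/
def cLoc (i : Fin G.N) (u v : L2Pair d) : ℝ :=
  ∫ x in G.K i, ((P.κ x)⁻¹ * ‖P.b x‖ ^ 2 * val u x * val v x + G.κt x * val u x * val v x)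

/-- `s = ∑_i s⁽ⁱ⁾`. -/
def s (u v : L2Pair d) : ℝ := ∑ i, G.sLoc i u v

/-- `c = ∑_i c⁽ⁱ⁾`. -/
def c (u v : L2Pair d) : ℝ := ∑ i, G.cLoc i u v

/-- The inner product `(u, v)_V = ∑_i (s⁽ⁱ⁾(u, v) + c⁽ⁱ⁾(u, v))`. -/
def innerV (u v : L2Pair d) : ℝ := ∑ i, (G.sLoc i u v + G.cLoc i u v)

/-- The norm `‖u‖_V`. -/
def normV (u : L2Pair d) : ℝ := √(G.innerV u u)

/-- The quotients `a(v, w) / ‖v‖_V` for nonzero `v ∈ V`. -/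
def wQuotients (w : L2Pair d) : Set ℝ :=
  {t | ∃ v ∈ P.V, v ≠ 0 ∧ t = P.a v w / G.normV v}

/-- The norm `‖w‖_W = sup_{v ∈ V} a(v, w) / ‖v‖_V`. -/
def normW (w : L2Pair d) : ℝ := sSup (G.wQuotients w)

/-- `(lam, φ)` is an eigenpair of `s⁽ⁱ⁾(φ, v) = lam c⁽ⁱ⁾(φ, v)` for all `v ∈ H¹(K_i)`. -/
structure IsEigenpair (i : Fin G.N) (lam : ℝ) (φ : L2Pair d) : Prop where
  mem : φ ∈ H1 (interior (G.K i))
  nonzero : G.cLoc i φ φ ≠ 0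
  eigen : ∀ v ∈ H1 (interior (G.K i)), G.sLoc i φ v = lam * G.cLoc i φ v

/-- `φ` lists the first `J` eigenfunctions on `K_i`, chosen `c⁽ⁱ⁾`-orthogonal, in the
non-decreasing order of the eigenvalues and with multiplicity: every eigenfunction orthogonal to
them belongs to an eigenvalue that is at least as large as theirs. -/
structure IsFirstEigenpairs (i : Fin G.N) (J : ℕ) (lam : Fin J → ℝ) (φ : Fin J → L2Pair d) :
    Prop where
  eigenpair : ∀ j, G.IsEigenpair i (lam j) (φ j)
  monotone : Monotone lam
  orthogonal : ∀ j k, j ≠ k → G.cLoc i (φ j) (φ k) = 0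
  first : ∀ μ ψ, G.IsEigenpair i μ ψ → (∀ j, G.cLoc i ψ (φ j) = 0) → ∀ j, lam j ≤ μ

/-- A choice, on every coarse element, of the number `J i` and of the first `J i` eigenfunctions;
these eigenfunctions span the auxiliary space. -/
structure AuxBasis where
  J : Fin G.N → ℕ
  lam : (i : Fin G.N) → Fin (J i) → ℝ
  φ : (i : Fin G.N) → Fin (J i) → L2Pair d
  isFirst : ∀ i, G.IsFirstEigenpairs i (J i) (lam i) (φ i)

/-- One trial basis function `q j ∈ V` per coarse node, supported in `ω_j`. -/
structure TrialBasis where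
  q : Fin G.Nc → L2Pair d
  q_mem : ∀ j, q j ∈ P.V
  q_support : ∀ j, ∀ᵐ x, x ∉ G.patch j → val (q j) x = 0

variable {G}

/-- The trial space `V_ms`. -/
def TrialBasis.Vms (Q : G.TrialBasis) : Submodule ℝ (L2Pair d) :=
  Submodule.span ℝ (Set.range Q.q)

namespace AuxBasis

variable (A : G.AuxBasis)

/-- The `c`-orthogonal projection
`π u = ∑_i ∑_j (c⁽ⁱ⁾(u, φ_j⁽ⁱ⁾) / c⁽ⁱ⁾(φ_j⁽ⁱ⁾, φ_j⁽ⁱ⁾)) φ_j⁽ⁱ⁾` onto the auxiliary space. -/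
def proj (u : L2Pair d) : L2Pair d :=
  ∑ i, ∑ j, (G.cLoc i u (A.φ i j) / G.cLoc i (A.φ i j) (A.φ i j)) • A.φ i j

/-- `ψ ∈ V` solves `a*(ψ, v) + c(π ψ, v) = c(φ_j⁽ⁱ⁾, π v)` for all `v ∈ V`. -/
def IsPsi (i : Fin G.N) (j : Fin (A.J i)) (ψ : L2Pair d) : Prop :=
  ψ ∈ P.V ∧ ∀ v ∈ P.V, P.aStar ψ v + G.c (A.proj ψ) v = G.c (A.φ i j) (A.proj v)

/-- `W_glo¹`, the span of the functions `ψ_j⁽ⁱ⁾`. -/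
def Wglo1 : Submodule ℝ (L2Pair d) :=
  Submodule.span ℝ {ψ | ∃ i j, A.IsPsi i j ψ}

/-- `ξ ∈ V₀(ω_i)` solves `a(v, ξ) = s(q_i, v)` for all `v ∈ V₀(ω_i)`. -/
def IsXi (Q : G.TrialBasis) (i : Fin G.Nc) (ξ : L2Pair d) : Prop :=
  ξ ∈ G.V0ω i ∧ ∀ v ∈ G.V0ω i, P.a v ξ = G.s (Q.q i) v

/-- `η ∈ V` solves `a*(η, v) + c(π η, π v) = (q_i, v)_V - a(v, ξ)` for all `v ∈ V`. -/
def IsEta (Q : G.TrialBasis) (i : Fin G.Nc) (ξ η : L2Pair d) : Prop :=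
  η ∈ P.V ∧ ∀ v ∈ P.V,
    P.aStar η v + G.c (A.proj η) (A.proj v) = G.innerV (Q.q i) v - P.a v ξ

/-- `W_glo²`, the span of the functions `η_i + ξ_i`. -/
def Wglo2 (Q : G.TrialBasis) : Submodule ℝ (L2Pair d) :=
  Submodule.span ℝ {w | ∃ i ξ η, IsXi Q i ξ ∧ A.IsEta Q i ξ η ∧ w = η + ξ}

/-- The global test space `W_glo = W_glo¹ + W_glo²`. -/
def Wglo (Q : G.TrialBasis) : Submodule ℝ (L2Pair d) := A.Wglo1 ⊔ A.Wglo2 Q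

/-- The quotients `a(v, z) / (‖v‖_V ‖z‖_W)` for nonzero `z ∈ W_glo`. -/
def stabQuotients (Q : G.TrialBasis) (v : L2Pair d) : Set ℝ :=
  {t | ∃ z ∈ A.Wglo Q, z ≠ 0 ∧ t = P.a v z / (G.normV v * G.normW z)}

end AuxBasis

end CoarseGrid

end MultiscaleStab

end

/-! The heart of the matter is that for `v ∈ V_ms` the representative `w` of `(·, v)_V` through `a`
lies in `W_glo`. For `v = q_i` the equation for `η_i` gives `a(u, η_i + ξ_i) = (q_i, u)_V - c(π η_i,
π u)`, so only the last functional must be compensated. It is a combination of the finitely many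
functionals `c(φ_k, ·)`, and so is `a(·, ψ)` for each `ψ` in the span of the `ψ_k`. The map from
coefficients of `ψ` to coefficients of that functional is injective because `a` is definite on `V`,
hence surjective by dimension (`exists_form_sum_eq_auxProj`). This gives `exists_mem_Wglo_basis`
and, by linearity, `exists_mem_Wglo`.

Given `w`, Cauchy-Schwarz with equality at `v` yields `‖w‖_W = ‖v‖_V` (`normW_eq_normV`). Thus `w`
attains the quotient 1, while the definition of `‖·‖_W` bounds every quotient by 1
(`isLUB_stabQuotients`).

All auxiliary problems are solvable by Lax-Milgram. Coercivity of `a` rests on the Poincaré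
inequality and on `θ b · ∇θ = ½ b · ∇(θ²)`, which integrates to zero; both are shown for test
functions and pass to the closure `H10`. -/

namespace MultiscaleStab

variable {d : ℕ}

/-! ### Integral forms with bounded coefficients as continuous bilinear forms -/

section BoundedBilinear

variable {α X Y : Type*} [MeasurableSpace α] {μ : Measure α}
  [NormedAddCommGroup X] [NormedSpace ℝ X] [NormedAddCommGroup Y] [NormedSpace ℝ Y]

omit [NormedSpace ℝ X] [NormedSpace ℝ Y] in
/-- The Cauchy-Schwarz inequality for the norms of two `L²` functions. -/
lemma integral_norm_mul_norm_le (f : Lp X 2 μ) (g : Lp Y 2 μ) :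
    Integrable (fun x => ‖f x‖ * ‖g x‖) μ ∧ ∫ x, ‖f x‖ * ‖g x‖ ∂μ ≤ ‖f‖ * ‖g‖ := by
  have hf := (Lp.memLp f).norm
  have hg := (Lp.memLp g).norm
  have h2 : ‖hf.toLp‖ = ‖f‖ := by rw [Lp.norm_toLp, eLpNorm_norm, Lp.norm_def]
  have h3 : ‖hg.toLp‖ = ‖g‖ := by rw [Lp.norm_toLp, eLpNorm_norm, Lp.norm_def]
  refine ⟨hf.integrable_mul hg, ?_⟩
  have h1 : ∫ x, ‖f x‖ * ‖g x‖ ∂μ = ⟪hf.toLp, hg.toLp⟫_ℝ := by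
    rw [L2.inner_def]
    apply integral_congr_ae
    filter_upwards [hf.coeFn_toLp, hg.coeFn_toLp] with x hx hy
    rw [hx, hy]
    simp [mul_comm]
  rw [h1, ← h2, ← h3]
  exact real_inner_le_norm _ _

/-- A bounded field of bilinear forms defines a bounded bilinear form on `L²`. -/
lemma exists_bilinear_setIntegral {S : Set α} {C : ℝ} (hC : 0 ≤ C) (β : α → X →ₗ[ℝ] Y →ₗ[ℝ] ℝ)
    (hβ : ∀ (f : Lp X 2 μ) (g : Lp Y 2 μ),
      AEStronglyMeasurable (fun x => β x (f x) (g x)) (μ.restrict S))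
    (hbd : ∀ᵐ x ∂(μ.restrict S), ∀ p q, |β x p q| ≤ C * (‖p‖ * ‖q‖)) :
    ∃ B : Lp X 2 μ →L[ℝ] Lp Y 2 μ →L[ℝ] ℝ, ∀ f g,
      IntegrableOn (fun x => β x (f x) (g x)) S μ ∧ B f g = ∫ x in S, β x (f x) (g x) ∂μ := by
  have hint : ∀ (f : Lp X 2 μ) (g : Lp Y 2 μ),
      IntegrableOn (fun x => β x (f x) (g x)) S μ := fun f g =>
    ((integral_norm_mul_norm_le f g).1.restrict.const_mul C).mono' (hβ f g)
      (hbd.mono fun x hx => hx _ _)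
  refine ⟨LinearMap.mkContinuous₂ (LinearMap.mk₂ ℝ (fun f g => ∫ x in S, β x (f x) (g x) ∂μ)
    ?_ ?_ ?_ ?_) C ?_, fun f g => ⟨hint f g, rfl⟩⟩
  · intro f f' g
    rw [← integral_add (hint f g) (hint f' g)]
    apply integral_congr_ae
    filter_upwards [ae_restrict_of_ae (Lp.coeFn_add f f')] with x hx
    rw [hx]
    simp
  · intro c f g
    rw [smul_eq_mul, ← integral_const_mul]
    apply integral_congr_ae
    filter_upwards [ae_restrict_of_ae (Lp.coeFn_smul c f)] with x hx
    rw [hx]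
    simp
  · intro f g g'
    rw [← integral_add (hint f g) (hint f g')]
    apply integral_congr_ae
    filter_upwards [ae_restrict_of_ae (Lp.coeFn_add g g')] with x hx
    rw [hx]
    simp
  · intro c f g
    rw [smul_eq_mul, ← integral_const_mul]
    apply integral_congr_ae
    filter_upwards [ae_restrict_of_ae (Lp.coeFn_smul c g)] with x hx
    rw [hx]
    simp
  · intro f g
    obtain ⟨hi, hle⟩ := integral_norm_mul_norm_le f g
    calc ‖∫ x in S, β x (f x) (g x) ∂μ‖ ≤ ∫ x in S, C * (‖f x‖ * ‖g x‖) ∂μ :=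
          norm_integral_le_of_norm_le (hi.restrict.const_mul C) (hbd.mono fun x hx => hx _ _)
      _ ≤ ∫ x, C * (‖f x‖ * ‖g x‖) ∂μ :=
          setIntegral_le_integral (hi.const_mul C) (ae_of_all _ fun x => by positivity)
      _ ≤ C * ‖f‖ * ‖g‖ := by
          rw [integral_const_mul, mul_assoc]
          gcongr

end BoundedBilinear

/-- Bounded bilinear forms on a space of `L²` pairs. -/
abbrev BilinForm (d : ℕ) := L2Pair d →L[ℝ] L2Pair d →L[ℝ] ℝ

/-- Pulls the abstract form back along the gradient component. The constant used is `|C|`, since on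
a null set the bound is vacuous and `C` may be negative. -/
lemma exists_bilin_grad_grad {S : Set (E d)} {m : E d → ℝ} {C : ℝ}
    (hm : AEStronglyMeasurable m (volume.restrict S))
    (hb : ∀ᵐ x ∂(volume.restrict S), |m x| ≤ C) :
    ∃ B : BilinForm d, ∀ u v,
      IntegrableOn (fun x => m x * ⟪grad u x, grad v x⟫_ℝ) S ∧
        B u v = ∫ x in S, m x * ⟪grad u x, grad v x⟫_ℝ := by
  obtain ⟨B, hB⟩ := exists_bilinear_setIntegral (μ := (volume : Measure (E d))) (S := S)
    (abs_nonneg C) (fun x => m x • innerₗ (E d))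
    (fun f g => hm.mul
      ((Lp.aestronglyMeasurable f).restrict.inner (𝕜 := ℝ) (Lp.aestronglyMeasurable g).restrict))
    (by
      filter_upwards [hb] with x hx p q
      simp only [LinearMap.smul_apply, innerₗ_apply_apply, smul_eq_mul, abs_mul]
      exact mul_le_mul (hx.trans (le_abs_self C)) (abs_real_inner_le_norm p q)
        (abs_nonneg _) (abs_nonneg C))
  let T := WithLp.sndL 2 ℝ (Lp ℝ 2 (volume : Measure (E d))) (Lp (E d) 2 (volume : Measure (E d)))
  exact ⟨B.bilinearComp T T, fun u v => hB u.snd v.snd⟩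

lemma exists_bilin_val_val {S : Set (E d)} {m : E d → ℝ} {C : ℝ}
    (hm : AEStronglyMeasurable m (volume.restrict S))
    (hb : ∀ᵐ x ∂(volume.restrict S), |m x| ≤ C) :
    ∃ B : BilinForm d, ∀ u v,
      IntegrableOn (fun x => m x * (val u x * val v x)) S ∧
        B u v = ∫ x in S, m x * (val u x * val v x) := by
  obtain ⟨B, hB⟩ := exists_bilinear_setIntegral (μ := (volume : Measure (E d))) (S := S)
    (abs_nonneg C) (fun x => m x • LinearMap.mul ℝ ℝ)
    (fun f g => hm.mul
      ((Lp.aestronglyMeasurable f).restrict.mul (Lp.aestronglyMeasurable g).restrict))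
    (by
      filter_upwards [hb] with x hx p q
      simp only [LinearMap.smul_apply, LinearMap.mul_apply', smul_eq_mul, abs_mul, Real.norm_eq_abs]
      exact mul_le_mul_of_nonneg_right (hx.trans (le_abs_self C)) (by positivity))
  let T := WithLp.fstL 2 ℝ (Lp ℝ 2 (volume : Measure (E d))) (Lp (E d) 2 (volume : Measure (E d)))
  exact ⟨B.bilinearComp T T, fun u v => hB u.fst v.fst⟩

lemma exists_bilin_grad_val {S : Set (E d)} {b : E d → E d} {C : ℝ}
    (hm : AEStronglyMeasurable b (volume.restrict S))
    (hb : ∀ᵐ x ∂(volume.restrict S), ‖b x‖ ≤ C) :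
    ∃ B : BilinForm d, ∀ u v,
      IntegrableOn (fun x => val v x * ⟪b x, grad u x⟫_ℝ) S ∧
        B u v = ∫ x in S, val v x * ⟪b x, grad u x⟫_ℝ := by
  obtain ⟨B, hB⟩ := exists_bilinear_setIntegral (μ := (volume : Measure (E d))) (S := S)
    (abs_nonneg C) (fun x => (innerₗ (E d) (b x)).smulRight (LinearMap.id : ℝ →ₗ[ℝ] ℝ))
    (fun f g => (hm.inner (𝕜 := ℝ) (Lp.aestronglyMeasurable f).restrict).mul
        (Lp.aestronglyMeasurable g).restrict)
    (by
      filter_upwards [hb] with x hx p q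
      simp only [LinearMap.smulRight_apply, innerₗ_apply_apply, LinearMap.smul_apply,
        LinearMap.id_apply, smul_eq_mul, abs_mul, Real.norm_eq_abs, ← mul_assoc]
      gcongr
      refine (abs_real_inner_le_norm (b x) p).trans ?_
      gcongr
      exact hx.trans (le_abs_self C))
  let T := WithLp.fstL 2 ℝ (Lp ℝ 2 (volume : Measure (E d))) (Lp (E d) 2 (volume : Measure (E d)))
  let T' := WithLp.sndL 2 ℝ (Lp ℝ 2 (volume : Measure (E d))) (Lp (E d) 2 (volume : Measure (E d)))
  exact ⟨B.bilinearComp T' T, fun u v => by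
    have := hB u.snd v.fst
    simp only [LinearMap.smulRight_apply, innerₗ_apply_apply, LinearMap.smul_apply,
      LinearMap.id_apply, smul_eq_mul, mul_comm] at this ⊢
    exact this⟩

/-! ### Test functions, the Poincaré inequality and passage to `H¹₀` -/

section TestFunctions

lemma norm_sq_eq_integral (u : L2Pair d) :
    ‖u‖ ^ 2 = (∫ x, val u x ^ 2) + ∫ x, ‖grad u x‖ ^ 2 := by
  rw [WithLp.prod_norm_sq_eq_of_L2, ← real_inner_self_eq_norm_sq, ← real_inner_self_eq_norm_sq,
    L2.inner_def, L2.inner_def]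
  simp only [real_inner_self_eq_norm_sq, Real.norm_eq_abs, sq_abs]
  rfl

variable {U : Set (E d)} {θ η : E d → ℝ}

lemma fderiv_apply_eq_inner_gradient (x e : E d) : fderiv ℝ θ x e = ⟪gradient θ x, e⟫_ℝ := by
  simp [gradient]

namespace IsTestFunction

lemma differentiable (h : IsTestFunction U θ) : Differentiable ℝ θ :=
  h.contDiff.differentiable (by simp)

lemma zero : IsTestFunction U (0 : E d → ℝ) :=
  ⟨contDiff_const, HasCompactSupport.zero, by simp [tsupport]⟩

lemma add (h : IsTestFunction U θ) (h' : IsTestFunction U η) : IsTestFunction U (θ + η) :=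
  ⟨h.contDiff.add h'.contDiff, h.hasCompactSupport.add h'.hasCompactSupport,
    (tsupport_add θ η).trans (Set.union_subset h.tsupport_subset h'.tsupport_subset)⟩

lemma smul (c : ℝ) (h : IsTestFunction U θ) : IsTestFunction U (c • θ) :=
  ⟨h.contDiff.const_smul c, h.hasCompactSupport.smul_left (f := fun _ => c),
    (tsupport_smul_subset_right (fun _ => c) θ).trans h.tsupport_subset⟩

/-- Both the Poincaré inequality and the vanishing of the convection energy come from integrating
against `θ²`. -/
lemma sq (h : IsTestFunction U θ) : IsTestFunction U (θ * θ) :=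
  ⟨h.contDiff.mul h.contDiff, h.hasCompactSupport.mul_left,
    (tsupport_mul_subset_left).trans h.tsupport_subset⟩

lemma mono {U' : Set (E d)} (hU : U ⊆ U') (h : IsTestFunction U θ) : IsTestFunction U' θ :=
  ⟨h.contDiff, h.hasCompactSupport, h.tsupport_subset.trans hU⟩

lemma gradient_add (h : IsTestFunction U θ) (h' : IsTestFunction U η) :
    gradient (θ + η) = gradient θ + gradient η := by
  ext1 x
  simp [gradient, fderiv_add (h.differentiable x) (h'.differentiable x)]

lemma gradient_smul (c : ℝ) (h : IsTestFunction U θ) : gradient (c • θ) = c • gradient θ := by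
  ext1 x
  simp [gradient, fderiv_const_smul (h.differentiable x)]

lemma gradient_sq (h : IsTestFunction U θ) (x : E d) :
    gradient (θ * θ) x = (2 * θ x) • gradient θ x := by
  simp [gradient, fderiv_mul (h.differentiable x) (h.differentiable x), two_mul, add_smul]

lemma continuous_gradient (h : IsTestFunction U θ) : Continuous (gradient θ) :=
  (InnerProductSpace.toDual ℝ (E d)).symm.continuous.comp (h.contDiff.continuous_fderiv (by simp))

lemma gradient_eq_zero (h : IsTestFunction U θ) {x : E d} (hx : x ∉ U) : gradient θ x = 0 := by
  have : fderiv ℝ θ x = 0 := by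
    by_contra hne
    exact hx (h.tsupport_subset (support_fderiv_subset ℝ hne))
  simp [gradient, this]

lemma eq_zero (h : IsTestFunction U θ) {x : E d} (hx : x ∉ U) : θ x = 0 :=
  image_eq_zero_of_notMem_tsupport fun hx' => hx (h.tsupport_subset hx')

lemma hasCompactSupport_gradient (h : IsTestFunction U θ) : HasCompactSupport (gradient θ) :=
  (h.hasCompactSupport.fderiv (𝕜 := ℝ)).mono fun x hx hx' => hx (by simp [gradient, hx'])

lemma integrable_sq (h : IsTestFunction U θ) : Integrable fun x => θ x ^ 2 :=
  (h.contDiff.continuous.pow 2).integrable_of_hasCompactSupport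
    (h.hasCompactSupport.mono fun x hx hx' => hx (by simp [hx']))

lemma integrable_norm_gradient_sq (h : IsTestFunction U θ) :
    Integrable fun x => ‖gradient θ x‖ ^ 2 :=
  (h.continuous_gradient.norm.pow 2).integrable_of_hasCompactSupport
    (h.hasCompactSupport_gradient.mono fun x hx hx' => hx (by simp [hx']))

/-- The Poincaré inequality. -/
lemma integral_sq_le (hd : 0 < d) {R : ℝ} (hU : U ⊆ Metric.closedBall 0 R)
    (h : IsTestFunction U θ) :
    ∫ x, θ x ^ 2 ≤ 4 * R ^ 2 * ∫ x, ‖gradient θ x‖ ^ 2 := by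
  let i : Fin d := ⟨0, hd⟩
  let e : E d := EuclideanSpace.single i 1
  let p : E d →L[ℝ] ℝ := EuclideanSpace.proj i
  have hpe : p e = 1 := by simp [p, e]
  have hpx : ∀ x, |p x| ≤ ‖x‖ := fun x => by simpa [p] using PiLp.norm_apply_le x i
  have he : ‖e‖ = 1 := by simp [e]
  have hfd : ∀ x, fderiv ℝ (θ * θ) x e = 2 * θ x * ⟪gradient θ x, e⟫_ℝ := fun x => by
    rw [fderiv_apply_eq_inner_gradient, h.gradient_sq, real_inner_smul_left]
  have hcs : HasCompactSupport fun x => p x * fderiv ℝ (θ * θ) x e := by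
    simp only [hfd]
    exact ((h.hasCompactSupport.mul_left (f := fun _ => (2 : ℝ))).mul_right
      (f' := fun x => ⟪gradient θ x, e⟫_ℝ)).mul_left (f := p)
  have hint : Integrable fun x => p x * fderiv ℝ (θ * θ) x e := by
    refine Continuous.integrable_of_hasCompactSupport ?_ hcs
    simp only [hfd]
    exact p.continuous.mul ((continuous_const.mul h.contDiff.continuous).mul
      (h.continuous_gradient.inner continuous_const))
  have hsq : ∀ x, (θ * θ) x = θ x ^ 2 := fun x => by simp [pow_two]
  -- Integration by parts against the coordinate `p`, whose derivative along `e` is 1: `∫ θ² = -∫ p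
  -- ∂ₑ(θ²)`.
  have key := integral_mul_fderiv_eq_neg_fderiv_mul_of_integrable (μ := (volume : Measure (E d)))
    (f := p) (g := θ * θ) (v := e) (by simpa [hpe, pow_two] using h.integrable_sq) hint
    (Continuous.integrable_of_hasCompactSupport
      (p.continuous.mul (h.contDiff.continuous.mul h.contDiff.continuous))
      (h.sq.hasCompactSupport.mul_left))
    (fun x _ => p.differentiableAt) (fun x _ => h.sq.differentiable x)
  simp only [ContinuousLinearMap.fderiv, hpe, one_mul, hsq] at key
  -- Young's inequality for `-2 θ p ∂ₑθ`, with `|p| ≤ R` on `U`. The term `½ ∫ θ²` is absorbed on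
  -- the left, which doubles `2 R²` to `4 R²`.
  have hle : -∫ x, p x * fderiv ℝ (θ * θ) x e
      ≤ ∫ x, (1 / 2 * θ x ^ 2 + 2 * R ^ 2 * ‖gradient θ x‖ ^ 2) := by
    rw [← integral_neg]
    refine integral_mono hint.neg ((h.integrable_sq.const_mul _).add
      (h.integrable_norm_gradient_sq.const_mul _)) fun x => ?_
    simp only [hfd]
    by_cases hx : x ∈ U
    · have h1 : |p x| ≤ R := (hpx x).trans (by simpa using hU hx)
      have h2 : |⟪gradient θ x, e⟫_ℝ| ≤ ‖gradient θ x‖ := by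
        simpa [he] using abs_real_inner_le_norm (gradient θ x) e
      have h3 : |p x * ⟪gradient θ x, e⟫_ℝ| ≤ R * ‖gradient θ x‖ := by
        rw [abs_mul]
        exact mul_le_mul h1 h2 (abs_nonneg _) ((abs_nonneg _).trans h1)
      have h4 : (p x * ⟪gradient θ x, e⟫_ℝ) ^ 2 ≤ (R * ‖gradient θ x‖) ^ 2 :=
        sq_le_sq' (abs_le.1 h3).1 (abs_le.1 h3).2
      nlinarith [sq_nonneg (θ x + 2 * (p x * ⟪gradient θ x, e⟫_ℝ))]
    · rw [h.eq_zero hx, h.gradient_eq_zero hx]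
      simp
  rw [integral_add (h.integrable_sq.const_mul _) (h.integrable_norm_gradient_sq.const_mul _),
    integral_const_mul, integral_const_mul] at hle
  linarith

end IsTestFunction

lemma H10_mono {U' : Set (E d)} (hU : U ⊆ U') : H10 U ≤ H10 U' := by
  refine Submodule.topologicalClosure_mono (Submodule.span_mono ?_)
  rintro u ⟨θ, h, h1, h2⟩
  exact ⟨θ, h.mono hU, h1, h2⟩

/-- A closed property of the test functions passes to `H¹₀(U)`. -/
lemma H10_induction {p : L2Pair d → Prop} (hp : IsClosed {u | p u})
    (htest : ∀ u θ, IsTestFunction U θ → val u =ᵐ[volume] θ → grad u =ᵐ[volume] gradient θ → p u)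
    {u : L2Pair d} (hu : u ∈ H10 U) : p u := by
  refine closure_minimal (fun u hu => ?_) hp hu
  -- Test functions form a vector space, so each element of the span comes from a single one.
  have : ∃ θ, IsTestFunction U θ ∧ val u =ᵐ[volume] θ ∧ grad u =ᵐ[volume] gradient θ := by
    refine Submodule.span_induction (fun u h => h) ?_ ?_ ?_ hu
    · refine ⟨0, .zero, Lp.coeFn_zero _ _ _, ?_⟩
      have : gradient (0 : E d → ℝ) = 0 := by ext1 x; simp [gradient]
      rw [this]
      exact Lp.coeFn_zero _ _ _
    · rintro u v - - ⟨θ, h, h1, h2⟩ ⟨η, h', h1', h2'⟩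
      refine ⟨θ + η, h.add h', (Lp.coeFn_add u.fst v.fst).trans (h1.add h1'), ?_⟩
      rw [h.gradient_add h']
      exact (Lp.coeFn_add u.snd v.snd).trans (h2.add h2')
    · rintro c u - ⟨θ, h, h1, h2⟩
      refine ⟨c • θ, h.smul c, (Lp.coeFn_smul c u.fst).trans (h1.const_smul c), ?_⟩
      rw [h.gradient_smul]
      exact (Lp.coeFn_smul c u.snd).trans (h2.const_smul c)
  obtain ⟨θ, h, h1, h2⟩ := this
  exact htest u θ h h1 h2

/-- On the test functions, the norm of `H¹` is controlled by the norm of the gradient. -/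
lemma exists_norm_sq_le_integral_grad (hd : 0 < d) (hU : Bornology.IsBounded U) :
    ∃ C : ℝ, 0 < C ∧ ∀ (u : L2Pair d) (θ : E d → ℝ), IsTestFunction U θ → val u =ᵐ[volume] θ →
      grad u =ᵐ[volume] gradient θ → ‖u‖ ^ 2 ≤ C * ∫ x in U, ‖grad u x‖ ^ 2 := by
  obtain ⟨R, hR⟩ := hU.subset_closedBall 0
  refine ⟨4 * R ^ 2 + 1, by positivity, fun u θ h h1 h2 => ?_⟩
  have e1 : ∫ x, val u x ^ 2 = ∫ x, θ x ^ 2 :=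
    integral_congr_ae (h1.mono fun x hx => by simp only [hx])
  have e2 : ∫ x, ‖grad u x‖ ^ 2 = ∫ x, ‖gradient θ x‖ ^ 2 :=
    integral_congr_ae (h2.mono fun x hx => by simp only [hx])
  have e3 : ∫ x in U, ‖grad u x‖ ^ 2 = ∫ x, ‖gradient θ x‖ ^ 2 := by
    rw [← setIntegral_eq_integral_of_forall_compl_eq_zero (s := U)
      (f := fun x => ‖gradient θ x‖ ^ 2) fun x hx => by simp [h.gradient_eq_zero hx]]
    exact integral_congr_ae (ae_restrict_of_ae (h2.mono fun x hx => by simp only [hx]))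
  rw [norm_sq_eq_integral, e1, e2, e3]
  linarith [h.integral_sq_le hd hR]

end TestFunctions

namespace ConvectionDiffusion

variable (P : ConvectionDiffusion d)

/-- A divergence free field does not contribute to the energy of a test function. -/
lemma integral_convection_eq_zero {u : L2Pair d} {θ : E d → ℝ} (h : IsTestFunction P.Ω θ)
    (h1 : val u =ᵐ[volume] θ) (h2 : grad u =ᵐ[volume] gradient θ) :
    ∫ x in P.Ω, val u x * ⟪P.b x, grad u x⟫_ℝ = 0 := by
  -- Test the divergence condition with `θ²`, where `∇(θ²) = 2 θ ∇θ`.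
  have key := P.b_divFree _ h.sq
  simp only [h.gradient_sq, inner_smul_right, mul_assoc] at key
  rw [integral_const_mul] at key
  rw [← (mul_eq_zero.1 key).resolve_left two_ne_zero]
  apply integral_congr_ae
  filter_upwards [ae_restrict_of_ae h1, ae_restrict_of_ae h2] with x hx hx'
  rw [hx, hx']

end ConvectionDiffusion

/-! ### Lax-Milgram and the abstract auxiliary projection -/

/-- The Lax-Milgram theorem on a closed subspace. -/
lemma exists_solution_of_coercive {H : Type*} [NormedAddCommGroup H] [InnerProductSpace ℝ H]
    [CompleteSpace H] {W : Submodule ℝ H} (hW : IsClosed (W : Set H)) (B : H →L[ℝ] H →L[ℝ] ℝ)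
    {γ : ℝ} (hγ : 0 < γ) (hB : ∀ u ∈ W, γ * ‖u‖ ^ 2 ≤ B u u) (f : H →L[ℝ] ℝ) :
    ∃ w ∈ W, ∀ v ∈ W, B v w = f v := by
  have : CompleteSpace W := hW.completeSpace_coe
  -- Flipped because the unknown sits in the second argument of `B`.
  let B' : W →L[ℝ] W →L[ℝ] ℝ := B.flip.bilinearComp W.subtypeL W.subtypeL
  have hB' : IsCoercive B' := ⟨γ, hγ, fun u => by
    simpa [B', pow_two, mul_assoc] using hB u u.2⟩
  let r : W := (InnerProductSpace.toDual ℝ W).symm (f.comp W.subtypeL)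
  refine ⟨hB'.continuousLinearEquivOfBilin.symm r, Subtype.mem _, fun v hv => ?_⟩
  have := hB'.continuousLinearEquivOfBilin_apply (hB'.continuousLinearEquivOfBilin.symm r) ⟨v, hv⟩
  rw [ContinuousLinearEquiv.apply_symm_apply, InnerProductSpace.toDual_symm_apply] at this
  simpa [B'] using this.symm

section AuxiliaryProjection

variable {H ι : Type*} [NormedAddCommGroup H] [InnerProductSpace ℝ H] [Fintype ι]
  (c : H →L[ℝ] H →L[ℝ] ℝ) (φ : ι → H)

/-- The projection onto the span of the `c`-orthogonal family `φ`. -/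
noncomputable def auxProj : H →L[ℝ] H := ∑ k, (c.flip (φ k)).smulRight ((c (φ k) (φ k))⁻¹ • φ k)

lemma auxProj_apply (u : H) : auxProj c φ u = ∑ k, (c u (φ k) / c (φ k) (φ k)) • φ k := by
  simp [auxProj, smul_smul, div_eq_mul_inv]

lemma form_auxProj (u v : H) :
    c (auxProj c φ u) v = ∑ k, c u (φ k) / c (φ k) (φ k) * c (φ k) v := by
  simp [auxProj_apply]

variable {c φ}

/-- The value is `∑ c(u, φ_k)² / c(φ_k, φ_k)`. Hence adding this form to `a` preserves coercivity.
-/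
lemma form_auxProj_self_nonneg (hsymm : ∀ u v, c u v = c v u) (hpos : ∀ u, 0 ≤ c u u) (u : H) :
    0 ≤ c (auxProj c φ u) u := by
  rw [form_auxProj]
  refine Finset.sum_nonneg fun k _ => ?_
  rw [hsymm (φ k) u, div_mul_eq_mul_div]
  exact div_nonneg (mul_self_nonneg _) (hpos _)

lemma form_apply_auxProj (hsymm : ∀ u v, c u v = c v u)
    (horth : ∀ k l, k ≠ l → c (φ k) (φ l) = 0) (hne : ∀ k, c (φ k) (φ k) ≠ 0) (k : ι) (v : H) :
    c (φ k) (auxProj c φ v) = c (φ k) v := by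
  rw [auxProj_apply, map_sum, Finset.sum_eq_single k]
  · rw [map_smul, smul_eq_mul, div_mul_cancel₀ _ (hne k), hsymm]
  · intro l _ hl
    rw [map_smul, horth k l hl.symm, smul_zero]
  · simp

/-- `c`-orthogonality lets the second projection be dropped, so the problems for `ψ` and `η` share
one left-hand side. -/
lemma form_auxProj_auxProj (hsymm : ∀ u v, c u v = c v u)
    (horth : ∀ k l, k ≠ l → c (φ k) (φ l) = 0) (hne : ∀ k, c (φ k) (φ k) ≠ 0) (u v : H) :
    c (auxProj c φ u) (auxProj c φ v) = c (auxProj c φ u) v := by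
  simp only [form_auxProj c φ u, form_apply_auxProj hsymm horth hne]

/-- The functionals `v ↦ c(π η, π v)` are represented, through the form `a`, by combinations of
the solutions `ψ k` of the auxiliary problems. -/
lemma exists_form_sum_eq_auxProj (hsymm : ∀ u v, c u v = c v u)
    (horth : ∀ k l, k ≠ l → c (φ k) (φ l) = 0) (hne : ∀ k, c (φ k) (φ k) ≠ 0)
    {a : H →L[ℝ] H →L[ℝ] ℝ} {W : Submodule ℝ H} (hdef : ∀ w ∈ W, a w w = 0 → w = 0)
    {ψ : ι → H} (hψW : ∀ k, ψ k ∈ W)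
    (hψ : ∀ k, ∀ v ∈ W, a v (ψ k) + c (auxProj c φ (ψ k)) v = c (φ k) (auxProj c φ v)) (η : H) :
    ∃ x : ι → ℝ, ∀ v ∈ W, a v (∑ k, x k • ψ k) = c (auxProj c φ η) (auxProj c φ v) := by
  let S : (ι → ℝ) →ₗ[ℝ] H := Fintype.linearCombination ℝ ψ
  have hS : ∀ x, S x = ∑ k, x k • ψ k := fun x => Fintype.linearCombination_apply ℝ ψ x
  have hSW : ∀ x, S x ∈ W := fun x => by
    rw [hS]
    exact W.sum_mem fun k _ => W.smul_mem _ (hψW k)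
  let coef : H →ₗ[ℝ] (ι → ℝ) :=
    LinearMap.pi fun k => (c (φ k) (φ k))⁻¹ • (c.flip (φ k) : H →ₗ[ℝ] ℝ)
  have hcoef : ∀ u k, coef u k = c u (φ k) / c (φ k) (φ k) := fun u k => by
    simp [coef, div_eq_inv_mul]
  -- Sum the equations for the `ψ k` with weights `x k`, moving the projection term to the right.
  have haS : ∀ x, ∀ v ∈ W, a v (S x) = ∑ k, (x k - coef (S x) k) * c (φ k) v := by
    intro x v hv
    have h1 : c (auxProj c φ (S x)) v = ∑ k, coef (S x) k * c (φ k) v := by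
      simp only [form_auxProj, hcoef]
    have h2 : a v (S x) + c (auxProj c φ (S x)) v = ∑ k, x k * c (φ k) v := by
      have h3 : c (auxProj c φ (S x)) v = ∑ k, x k * c (auxProj c φ (ψ k)) v := by
        simp [hS]
      rw [h3, hS, map_sum, ← Finset.sum_add_distrib]
      refine Finset.sum_congr rfl fun k _ => ?_
      rw [map_smul, smul_eq_mul, ← mul_add, hψ k v hv, form_apply_auxProj hsymm horth hne]
    simp only [sub_mul, Finset.sum_sub_distrib]
    linarith
  -- By `haS`, `M x` lists coefficients of `a(·, S x)` in the functionals `c(φ k, ·)`; the target is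
  -- `coef η`. If `M x = 0`, then `a(S x, S x) = 0`, so `S x = 0` and `x = M x = 0`.
  let M : (ι → ℝ) →ₗ[ℝ] (ι → ℝ) := LinearMap.id - coef ∘ₗ S
  have hM : ∀ x k, M x k = x k - coef (S x) k := fun x k => rfl
  have hinj : Function.Injective M := by
    rw [← LinearMap.ker_eq_bot, LinearMap.ker_eq_bot']
    intro x hx
    have h0 : S x = 0 := by
      refine hdef _ (hSW x) ?_
      rw [haS x _ (hSW x)]
      refine Finset.sum_eq_zero fun k _ => ?_
      rw [← hM, hx, Pi.zero_apply, zero_mul]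
    ext k
    have := congrFun hx k
    rw [hM, h0, map_zero] at this
    simpa using this
  obtain ⟨x, hx⟩ := LinearMap.surjective_of_injective hinj (coef η)
  refine ⟨x, fun v hv => ?_⟩
  rw [form_auxProj_auxProj hsymm horth hne, ← hS, haS x v hv, form_auxProj]
  refine Finset.sum_congr rfl fun k _ => ?_
  rw [← hM, hx, hcoef]

end AuxiliaryProjection

/-! ### Boundedness and coercivity of `a` -/

namespace ConvectionDiffusion

variable (P : ConvectionDiffusion d)

lemma exists_bounds : ∃ κ₀ κ₁ : ℝ, 0 < κ₀ ∧ 0 ≤ κ₁ ∧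
    ∀ᵐ x ∂(volume.restrict P.Ω), κ₀ ≤ P.κ x ∧ P.κ x ≤ κ₁ := by
  obtain ⟨κ₀, κ₁, h0, h⟩ := P.κ_bounds
  -- If the domain is empty, nothing forces `κ₁` to be nonnegative.
  exact ⟨κ₀, |κ₁|, h0, abs_nonneg _, h.mono fun x hx => ⟨hx.1, hx.2.trans (le_abs_self _)⟩⟩

/-- The diffusion part of the form `a`. -/
lemma exists_diffusion : ∃ B : BilinForm d, ∀ u v,
    IntegrableOn (fun x => P.κ x * ⟪grad u x, grad v x⟫_ℝ) P.Ω ∧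
      B u v = ∫ x in P.Ω, P.κ x * ⟪grad u x, grad v x⟫_ℝ := by
  obtain ⟨κ₀, κ₁, h0, -, h⟩ := P.exists_bounds
  exact exists_bilin_grad_grad (C := κ₁) P.κ_meas (h.mono fun x hx => by
    rw [abs_of_nonneg (h0.le.trans hx.1)]
    exact hx.2)

/-- The diffusion form is coercive on the test functions. -/
lemma exists_coercive_test (hd : 0 < d) : ∃ γ : ℝ, 0 < γ ∧ ∀ (u : L2Pair d) (θ : E d → ℝ),
    IsTestFunction P.Ω θ → val u =ᵐ[volume] θ → grad u =ᵐ[volume] gradient θ →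
      γ * ‖u‖ ^ 2 ≤ ∫ x in P.Ω, P.κ x * ⟪grad u x, grad u x⟫_ℝ := by
  obtain ⟨κ₀, κ₁, h0, -, h⟩ := P.exists_bounds
  obtain ⟨C, hC, hle⟩ := exists_norm_sq_le_integral_grad hd P.isBounded_domain
  obtain ⟨B, hB⟩ := P.exists_diffusion
  refine ⟨κ₀ / C, by positivity, fun u θ ht h1 h2 => ?_⟩
  calc κ₀ / C * ‖u‖ ^ 2 ≤ κ₀ / C * (C * ∫ x in P.Ω, ‖grad u x‖ ^ 2) := by
        gcongr
        exact hle u θ ht h1 h2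
    _ = ∫ x in P.Ω, κ₀ * ‖grad u x‖ ^ 2 := by
        rw [integral_const_mul]
        field_simp
    _ ≤ ∫ x in P.Ω, P.κ x * ⟪grad u x, grad u x⟫_ℝ := by
        refine integral_mono_of_nonneg (ae_of_all _ fun x => by positivity) (hB u u).1 ?_
        filter_upwards [h] with x hx
        rw [real_inner_self_eq_norm_sq]
        exact mul_le_mul_of_nonneg_right hx.1 (by positivity)

/-- The form `a` is bounded, and coercive on `V`. -/
lemma exists_form_a (hd : 0 < d) : ∃ B : BilinForm d, (∀ u v, P.a u v = B u v) ∧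
    ∃ γ : ℝ, 0 < γ ∧ ∀ u ∈ P.V, γ * ‖u‖ ^ 2 ≤ B u u := by
  obtain ⟨B₁, h₁⟩ := P.exists_diffusion
  obtain ⟨M, hM⟩ := P.b_bounded
  obtain ⟨B₂, h₂⟩ := exists_bilin_grad_val P.b_meas hM
  obtain ⟨γ, hγ, hle⟩ := P.exists_coercive_test hd
  refine ⟨B₁ + B₂, fun u v => ?_, γ, hγ, fun u hu => ?_⟩
  · rw [add_apply, add_apply, (h₁ u v).2, (h₂ u v).2,
      ← integral_add (h₁ u v).1 (h₂ u v).1]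
    rfl
  · refine H10_induction (p := fun u => γ * ‖u‖ ^ 2 ≤ (B₁ + B₂) u u)
      (isClosed_le (by fun_prop) (by fun_prop)) (fun u θ ht hv hg => ?_) hu
    rw [add_apply, add_apply, (h₁ u u).2, (h₂ u u).2,
      P.integral_convection_eq_zero ht hv hg, add_zero]
    exact hle u θ ht hv hg

end ConvectionDiffusion

/-! ### The forms `s` and `c` on the coarse grid -/

namespace CoarseGrid

variable {P : ConvectionDiffusion d} (G : CoarseGrid P)

lemma interior_ae_eq (i : Fin G.N) : interior (G.K i) =ᵐ[volume] G.K i :=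
  interior_ae_eq_of_null_frontier (G.frontier_K i)

lemma restrict_K (i : Fin G.N) :
    (volume : Measure (E d)).restrict (G.K i) = volume.restrict (interior (G.K i)) :=
  (Measure.restrict_congr_set (G.interior_ae_eq i)).symm

/-- An element may touch the boundary of the domain, but its interior lies in the domain and its
frontier is null. -/
lemma restrict_K_le (i : Fin G.N) :
    (volume : Measure (E d)).restrict (G.K i) ≤ volume.restrict P.Ω := by
  rw [G.restrict_K]
  exact Measure.restrict_mono (G.interior_subset i) le_rfl

lemma ae_of_ae_domain {p : E d → Prop} (h : ∀ᵐ x ∂(volume.restrict P.Ω), p x) (i : Fin G.N) :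
    ∀ᵐ x ∂(volume.restrict (G.K i)), p x :=
  ae_mono (G.restrict_K_le i) h

lemma ae_mem_interior (i : Fin G.N) : ∀ᵐ x ∂(volume.restrict (G.K i)), x ∈ interior (G.K i) := by
  rw [G.restrict_K]
  exact ae_restrict_mem isOpen_interior.measurableSet

/-- The elements exhaust the domain up to a null set. -/
lemma sum_setIntegral_eq {f : E d → ℝ} (hf : IntegrableOn f P.Ω) :
    ∑ i, ∫ x in G.K i, f x = ∫ x in P.Ω, f x := by
  simp only [G.restrict_K]
  rw [← integral_iUnion_fintype (fun i => isOpen_interior.measurableSet)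
    (fun i k h => G.disjoint_interior i k h) fun i => hf.mono_set (G.interior_subset i)]
  refine setIntegral_congr_set (Filter.EventuallyLE.antisymm
    (Set.iUnion_subset G.interior_subset).eventuallyLE ?_)
  have h1 : P.Ω ≤ᵐ[volume] ⋃ i, G.K i := by
    rw [G.cover]
    exact subset_closure.eventuallyLE
  exact h1.trans (Filter.EventuallyEq.countable_iUnion fun i => G.interior_ae_eq i).symm.le

lemma sLoc_comm (i : Fin G.N) (u v : L2Pair d) : G.sLoc i u v = G.sLoc i v u := by
  simp only [sLoc, real_inner_comm]

lemma cLoc_comm (i : Fin G.N) (u v : L2Pair d) : G.cLoc i u v = G.cLoc i v u := by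
  refine integral_congr_ae (ae_of_all _ fun x => ?_)
  dsimp only
  ring

lemma sLoc_self_nonneg (i : Fin G.N) (u : L2Pair d) : 0 ≤ G.sLoc i u u := by
  obtain ⟨κ₀, κ₁, h0, -, h⟩ := P.exists_bounds
  refine integral_nonneg_of_ae ?_
  filter_upwards [G.ae_of_ae_domain h i] with x hx
  exact mul_nonneg (h0.le.trans hx.1) real_inner_self_nonneg

lemma cLoc_self_nonneg (i : Fin G.N) (u : L2Pair d) : 0 ≤ G.cLoc i u u := by
  obtain ⟨κ₀, κ₁, h0, -, h⟩ := P.exists_bounds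
  refine integral_nonneg_of_ae ?_
  filter_upwards [G.ae_of_ae_domain h i] with x hx
  have h1 : 0 ≤ P.κ x := h0.le.trans hx.1
  have h2 : 0 ≤ G.κt x := mul_nonneg h1 (Finset.sum_nonneg fun j _ => norm_nonneg _)
  simp only [mul_assoc, Pi.zero_apply]
  have := mul_self_nonneg (val u x)
  positivity

lemma exists_form_sLoc (i : Fin G.N) : ∃ B : BilinForm d, ∀ u v, G.sLoc i u v = B u v := by
  obtain ⟨κ₀, κ₁, h0, -, h⟩ := P.exists_bounds
  obtain ⟨B, hB⟩ := exists_bilin_grad_grad (C := κ₁) (P.κ_meas.mono_measure (G.restrict_K_le i))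
    ((G.ae_of_ae_domain h i).mono fun x hx => by
      rw [abs_of_nonneg (h0.le.trans hx.1)]
      exact hx.2)
  exact ⟨B, fun u v => (hB u v).2.symm⟩

lemma norm_gradient_eq (f : E d → ℝ) (x : E d) : ‖gradient f x‖ = ‖fderiv ℝ f x‖ := by
  simp [gradient]

/-- The weight is bounded: `κ ≥ κ₀` controls `κ⁻¹ |b|²`, and at interior points the Lipschitz
constants bound the gradients of the `χ j`. -/
lemma exists_form_cLoc (i : Fin G.N) : ∃ B : BilinForm d, ∀ u v, G.cLoc i u v = B u v := by
  obtain ⟨κ₀, κ₁, h0, h1, h⟩ := P.exists_bounds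
  obtain ⟨M, hM⟩ := P.b_bounded
  choose L hL using fun j => G.χ_lipschitz j i
  have hm : AEStronglyMeasurable (fun x => (P.κ x)⁻¹ * ‖P.b x‖ ^ 2 + G.κt x)
      (volume.restrict (G.K i)) := by
    refine AEStronglyMeasurable.mono_measure ?_ (G.restrict_K_le i)
    refine (P.κ_meas.aemeasurable.inv.aestronglyMeasurable.mul (P.b_meas.norm.pow 2)).add
      (P.κ_meas.mul (Measurable.aestronglyMeasurable ?_))
    simp only [norm_gradient_eq]
    -- The total derivative function, zero by default where `χ j` is not differentiable, is
    -- measurable for any `χ j`.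
    exact Finset.measurable_fun_sum _ fun j _ => (measurable_fderiv ℝ (G.χ j)).norm
  obtain ⟨B, hB⟩ := exists_bilin_val_val (C := κ₀⁻¹ * M ^ 2 + κ₁ * ∑ j, (L j : ℝ)) hm (by
    filter_upwards [G.ae_of_ae_domain h i, G.ae_of_ae_domain hM i, G.ae_mem_interior i]
      with x hx hx' hxi
    have h2 : 0 ≤ P.κ x := h0.le.trans hx.1
    have h3 : 0 ≤ G.κt x := mul_nonneg h2 (Finset.sum_nonneg fun j _ => norm_nonneg _)
    rw [abs_of_nonneg (by positivity)]
    refine add_le_add ?_ ?_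
    · have := hx.1
      gcongr
    · refine mul_le_mul hx.2 (Finset.sum_le_sum fun j _ => ?_)
        (Finset.sum_nonneg fun j _ => norm_nonneg _) h1
      rw [norm_gradient_eq]
      exact norm_fderiv_le_of_lipschitzOn ℝ (mem_interior_iff_mem_nhds.1 hxi) (hL j))
  refine ⟨B, fun u v => ?_⟩
  rw [(hB u v).2]
  refine integral_congr_ae (ae_of_all _ fun x => ?_)
  dsimp only
  ring

lemma exists_form_c : ∃ B : BilinForm d, ∀ u v, G.c u v = B u v := by
  choose B hB using G.exists_form_cLoc
  exact ⟨∑ i, B i, fun u v => by simp [c, hB]⟩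

lemma exists_form_s : ∃ B : BilinForm d, ∀ u v, G.s u v = B u v := by
  choose B hB using G.exists_form_sLoc
  exact ⟨∑ i, B i, fun u v => by simp [s, hB]⟩

lemma innerV_eq (u v : L2Pair d) : G.innerV u v = G.s u v + G.c u v :=
  Finset.sum_add_distrib

/-- Summed over the elements, `s` is the diffusion form on the whole domain, already coercive on
test functions. -/
lemma exists_coercive_s (hd : 0 < d) : ∃ γ : ℝ, 0 < γ ∧ ∀ u ∈ P.V, γ * ‖u‖ ^ 2 ≤ G.s u u := by
  obtain ⟨γ, hγ, hle⟩ := P.exists_coercive_test hd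
  obtain ⟨B, hB⟩ := P.exists_diffusion
  have hs : ∀ u, G.s u u = B u u := fun u => by
    rw [(hB u u).2]
    exact G.sum_setIntegral_eq (hB u u).1
  refine ⟨γ, hγ, fun u hu => ?_⟩
  rw [hs]
  refine H10_induction (p := fun u => γ * ‖u‖ ^ 2 ≤ B u u)
    (isClosed_le (by fun_prop) (by fun_prop)) (fun u θ ht hv hg => ?_) hu
  rw [(hB u u).2]
  exact hle u θ ht hv hg

lemma c_comm (u v : L2Pair d) : G.c u v = G.c v u :=
  Finset.sum_congr rfl fun i _ => G.cLoc_comm i u v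

lemma s_comm (u v : L2Pair d) : G.s u v = G.s v u :=
  Finset.sum_congr rfl fun i _ => G.sLoc_comm i u v

lemma c_self_nonneg (u : L2Pair d) : 0 ≤ G.c u u :=
  Finset.sum_nonneg fun i _ => G.cLoc_self_nonneg i u

/-- Functions in `H¹(K_i)`, extended by zero, do not see the other elements. -/
lemma cLoc_eq_zero {i k : Fin G.N} (hik : k ≠ i) {φ : L2Pair d} (hφ : φ ∈ H1 (interior (G.K i)))
    (u : L2Pair d) : G.cLoc k u φ = 0 := by
  refine integral_eq_zero_of_ae ?_
  filter_upwards [G.ae_mem_interior k, ae_restrict_of_ae hφ.1] with x hx hx'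
  have := (hx' fun h => (Set.disjoint_left.1 (G.disjoint_interior k i hik)) hx h).1
  simp [this]

lemma c_eq_cLoc {i : Fin G.N} {φ : L2Pair d} (hφ : φ ∈ H1 (interior (G.K i))) (u : L2Pair d) :
    G.c u φ = G.cLoc i u φ :=
  Finset.sum_eq_single i (fun _ _ hk => G.cLoc_eq_zero hk hφ u) (by simp)

namespace AuxBasis

variable {G} (A : G.AuxBasis)

/-- The auxiliary eigenfunctions of all elements as one family. -/
def fam (k : Σ i, Fin (A.J i)) : L2Pair d := A.φ k.1 k.2

lemma fam_mem (k : Σ i, Fin (A.J i)) : A.fam k ∈ H1 (interior (G.K k.1)) :=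
  ((A.isFirst k.1).eigenpair k.2).mem

lemma c_fam_self_ne_zero (k : Σ i, Fin (A.J i)) : G.c (A.fam k) (A.fam k) ≠ 0 := by
  rw [G.c_eq_cLoc (A.fam_mem k)]
  exact ((A.isFirst k.1).eigenpair k.2).nonzero

lemma c_fam_fam (k l : Σ i, Fin (A.J i)) (h : k ≠ l) : G.c (A.fam k) (A.fam l) = 0 := by
  rw [G.c_eq_cLoc (A.fam_mem l)]
  by_cases hi : l.1 = k.1
  · obtain ⟨i, j⟩ := k
    obtain ⟨i', j'⟩ := l
    obtain rfl : i' = i := hi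
    exact (A.isFirst i').orthogonal j j' fun hj => h (by rw [hj])
  · rw [G.cLoc_comm]
    exact G.cLoc_eq_zero hi (A.fam_mem k) _

/-- Each eigenfunction vanishes off its own element, so local and global coefficients agree and the
abstract results apply to `π`. -/
lemma proj_eq_auxProj {B : BilinForm d} (hB : ∀ u v, G.c u v = B u v) (u : L2Pair d) :
    A.proj u = auxProj B A.fam u := by
  rw [auxProj_apply, Fintype.sum_sigma]
  refine Finset.sum_congr rfl fun i _ => Finset.sum_congr rfl fun j _ => ?_
  rw [← hB, ← hB, G.c_eq_cLoc (A.fam_mem ⟨i, j⟩), G.c_eq_cLoc (A.fam_mem ⟨i, j⟩)]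
  rfl

end AuxBasis

end CoarseGrid

/-- The Cauchy-Schwarz inequality for a nonnegative symmetric form. -/
lemma form_sq_le {H : Type*} [NormedAddCommGroup H] [NormedSpace ℝ H]
    (B : H →L[ℝ] H →L[ℝ] ℝ) (hsymm : ∀ u v, B u v = B v u) (hpos : ∀ u, 0 ≤ B u u) (u v : H) :
    B u v ^ 2 ≤ B u u * B v v :=
  LinearMap.BilinForm.apply_sq_le_of_symm B.toLinearMap₁₂ hpos ⟨hsymm⟩ u v

/-! ### Representatives in `W_glo` -/

namespace CoarseGrid

variable {P : ConvectionDiffusion d} {G : CoarseGrid P}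

lemma V0ω_le (j : Fin G.Nc) : G.V0ω j ≤ P.V := H10_mono Set.inter_subset_left

lemma isClosed_H10 (U : Set (E d)) : IsClosed (H10 U : Set (L2Pair d)) :=
  Submodule.isClosed_topologicalClosure _

lemma TrialBasis.Vms_le (Q : G.TrialBasis) : Q.Vms ≤ P.V :=
  Submodule.span_le.2 (Set.range_subset_iff.2 Q.q_mem)

lemma AuxBasis.Wglo_le (A : G.AuxBasis) (Q : G.TrialBasis) : A.Wglo Q ≤ P.V := by
  refine sup_le (Submodule.span_le.2 ?_) (Submodule.span_le.2 ?_)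
  · rintro ψ ⟨i, j, h, -⟩
    exact h
  · rintro w ⟨i, ξ, η, hξ, hη, rfl⟩
    exact P.V.add_mem hη.1 (V0ω_le i hξ.1)

/-- The form `a` is definite on `V`. -/
lemma eq_zero_of_a_self_eq_zero (hd : 0 < d) {w : L2Pair d} (hw : w ∈ P.V) (h : P.a w w = 0) :
    w = 0 := by
  obtain ⟨a, ha, γ, hγ, hco⟩ := P.exists_form_a hd
  have h1 := hco w hw
  rw [← ha, h] at h1
  have h2 : ‖w‖ ^ 2 ≤ 0 := nonpos_of_mul_nonpos_right h1 hγ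
  simpa using le_antisymm h2 (sq_nonneg _)

/-- Every trial basis function has its Riesz representative with respect to `a` in `W_glo`. -/
lemma exists_mem_Wglo_basis (hd : 0 < d) (A : G.AuxBasis) (Q : G.TrialBasis) (i : Fin G.Nc) :
    ∃ w ∈ A.Wglo Q, ∀ u ∈ P.V, G.innerV u (Q.q i) = P.a u w := by
  obtain ⟨a, ha, γ, hγ, hco⟩ := P.exists_form_a hd
  obtain ⟨c, hc⟩ := G.exists_form_c
  obtain ⟨s, hs⟩ := G.exists_form_s
  have hpr := A.proj_eq_auxProj hc
  have hsymm : ∀ u v, c u v = c v u := fun u v => by rw [← hc, ← hc, G.c_comm]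
  have hpos : ∀ u, 0 ≤ c u u := fun u => by
    rw [← hc]
    exact G.c_self_nonneg u
  have horth : ∀ k l, k ≠ l → c (A.fam k) (A.fam l) = 0 := fun k l h => by
    rw [← hc, A.c_fam_fam k l h]
  have hne : ∀ k, c (A.fam k) (A.fam k) ≠ 0 := fun k => by
    rw [← hc]
    exact A.c_fam_self_ne_zero k
  have hV : IsClosed (P.V : Set (L2Pair d)) := isClosed_H10 _
  let pr := auxProj c A.fam
  -- The coercive form whose second argument is the unknown; it yields both the `ψ k` and `η`.
  let aπ : BilinForm d := a + (c.comp pr).flip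
  have haπ : ∀ u v, aπ u v = a u v + c (pr v) u := fun u v => rfl
  have hcoπ : ∀ u ∈ P.V, γ * ‖u‖ ^ 2 ≤ aπ u u := fun u hu => by
    rw [haπ]
    exact (hco u hu).trans (le_add_of_nonneg_right (form_auxProj_self_nonneg hsymm hpos u))
  choose ψ hψV hψ using fun k => exists_solution_of_coercive hV aπ hγ hcoπ ((c (A.fam k)).comp pr)
  obtain ⟨ξ, hξV, hξ⟩ := exists_solution_of_coercive (isClosed_H10 _) a hγ
    (fun u hu => hco u (V0ω_le i hu)) (s (Q.q i))
  obtain ⟨η, hηV, hη⟩ := exists_solution_of_coercive hV aπ hγ hcoπ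
    ((s + c) (Q.q i) - a.flip ξ)
  obtain ⟨x, hx⟩ := exists_form_sum_eq_auxProj hsymm horth hne
    (fun w hw h => eq_zero_of_a_self_eq_zero hd hw (by rw [ha, h])) hψV
    (fun k v hv => hψ k v hv) η
  have hη' : ∀ v ∈ P.V, a v η + c (pr η) (pr v) = s (Q.q i) v + c (Q.q i) v - a v ξ :=
    fun v hv => by
      have := hη v hv
      rw [haπ] at this
      rw [form_auxProj_auxProj hsymm horth hne, this]
      rfl
  -- The combination of the `ψ k` restores `c(π η, π u)`, and `a(u, ξ)` cancels the term subtracted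
  -- in the equation for `η`.
  refine ⟨∑ k, x k • ψ k + (η + ξ), Submodule.add_mem_sup ?_ (Submodule.subset_span ?_),
    fun u hu => ?_⟩
  · refine Submodule.sum_mem _ fun k _ => Submodule.smul_mem _ _ (Submodule.subset_span ?_)
    refine ⟨k.1, k.2, hψV k, fun v hv => ?_⟩
    rw [ConvectionDiffusion.aStar, ha, hpr, hpr, hc, hc]
    exact hψ k v hv
  · refine ⟨i, ξ, η, ⟨hξV, fun v hv => ?_⟩, ⟨hηV, fun v hv => ?_⟩, rfl⟩
    · rw [ha, hs]
      exact hξ v hv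
    · rw [ConvectionDiffusion.aStar, ha, ha, hpr, hpr, hc, G.innerV_eq, hs, hc]
      exact hη' v hv
  · rw [G.innerV_eq, ha, hs, hc, map_add, map_add, hx u hu, hsymm]
    have h1 : s u (Q.q i) = s (Q.q i) u := by rw [← hs, ← hs, G.s_comm]
    have := hη' u hu
    rw [h1]
    linarith

lemma exists_mem_Wglo (hd : 0 < d) (A : G.AuxBasis) (Q : G.TrialBasis) {v : L2Pair d}
    (hv : v ∈ Q.Vms) : ∃ w ∈ A.Wglo Q, ∀ u ∈ P.V, G.innerV u v = P.a u w := by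
  obtain ⟨a, ha, -⟩ := P.exists_form_a hd
  obtain ⟨c, hc⟩ := G.exists_form_c
  obtain ⟨s, hs⟩ := G.exists_form_s
  have hi : ∀ u v, G.innerV u v = (s + c) u v := fun u v => by
    rw [G.innerV_eq, hs, hc]
    rfl
  refine Submodule.span_induction ?_ ?_ ?_ ?_ hv
  · rintro _ ⟨i, rfl⟩
    exact exists_mem_Wglo_basis hd A Q i
  · exact ⟨0, Submodule.zero_mem _, fun u _ => by rw [hi, ha, map_zero, map_zero]⟩
  · rintro v₁ v₂ - - ⟨w₁, h₁, e₁⟩ ⟨w₂, h₂, e₂⟩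
    refine ⟨w₁ + w₂, Submodule.add_mem _ h₁ h₂, fun u hu => ?_⟩
    rw [hi, ha, map_add, map_add, ← hi, ← hi, ← ha, ← ha, e₁ u hu, e₂ u hu]
  · rintro t v₁ - ⟨w₁, h₁, e₁⟩
    refine ⟨t • w₁, Submodule.smul_mem _ _ h₁, fun u hu => ?_⟩
    rw [hi, ha, map_smul, map_smul, ← hi, ← ha, e₁ u hu]

/-! ### The norms of `V` and `W` and the inf-sup constant -/

lemma innerV_self_nonneg (u : L2Pair d) : 0 ≤ G.innerV u u :=
  Finset.sum_nonneg fun i _ => add_nonneg (G.sLoc_self_nonneg i u) (G.cLoc_self_nonneg i u)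

lemma normV_sq (u : L2Pair d) : G.normV u ^ 2 = G.innerV u u :=
  Real.sq_sqrt (innerV_self_nonneg u)

lemma exists_norm_le_normV (hd : 0 < d) (G : CoarseGrid P) :
    ∃ γ : ℝ, 0 < γ ∧ ∀ u ∈ P.V, γ * ‖u‖ ≤ G.normV u := by
  obtain ⟨γ, hγ, h⟩ := G.exists_coercive_s hd
  refine ⟨√γ, Real.sqrt_pos.2 hγ, fun u hu => ?_⟩
  refine Real.le_sqrt_of_sq_le ?_
  rw [mul_pow, Real.sq_sqrt hγ.le, G.innerV_eq]
  exact (h u hu).trans (le_add_of_nonneg_right (G.c_self_nonneg u))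

lemma normV_pos (hd : 0 < d) {u : L2Pair d} (hu : u ∈ P.V) (h0 : u ≠ 0) : 0 < G.normV u := by
  obtain ⟨γ, hγ, h⟩ := exists_norm_le_normV hd G
  exact (mul_pos hγ (norm_pos_iff.2 h0)).trans_le (h u hu)

/-- The Cauchy-Schwarz inequality for the inner product of `V`. -/
lemma innerV_le (u v : L2Pair d) : G.innerV u v ≤ G.normV u * G.normV v := by
  obtain ⟨c, hc⟩ := G.exists_form_c
  obtain ⟨s, hs⟩ := G.exists_form_s
  have hi : ∀ u v, G.innerV u v = (s + c) u v := fun u v => by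
    rw [G.innerV_eq, hs, hc]
    rfl
  have h := form_sq_le (s + c) (fun u v => by
    rw [← hi, ← hi, G.innerV_eq, G.innerV_eq, G.s_comm, G.c_comm])
    (fun x => (innerV_self_nonneg x).trans_eq (hi x x)) u v
  rw [← hi, ← hi, ← hi, ← normV_sq, ← normV_sq, ← mul_pow] at h
  exact (abs_le_of_sq_le_sq' h (mul_nonneg (Real.sqrt_nonneg _) (Real.sqrt_nonneg _))).2

/-- A nonzero element of `V` makes the set of quotients nonempty; continuity of `a` and `γ ‖v‖ ≤
‖v‖_V` bound it above. -/
lemma isLUB_normW (hd : 0 < d) (hV : ∃ v ∈ P.V, v ≠ 0) (w : L2Pair d) :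
    IsLUB (G.wQuotients w) (G.normW w) := by
  obtain ⟨a, ha, -⟩ := P.exists_form_a hd
  obtain ⟨γ, hγ, h⟩ := exists_norm_le_normV hd G
  obtain ⟨v₀, hv₀, hne⟩ := hV
  refine isLUB_csSup ⟨_, v₀, hv₀, hne, rfl⟩ ⟨‖a‖ * ‖w‖ / γ, ?_⟩
  rintro _ ⟨v, hv, hv0, rfl⟩
  rw [div_le_div_iff₀ (normV_pos hd hv hv0) hγ, ha]
  calc a v w * γ ≤ ‖a‖ * ‖v‖ * ‖w‖ * γ := by
        gcongr
        exact (le_abs_self _).trans (a.le_opNorm₂ v w)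
    _ = ‖a‖ * ‖w‖ * (γ * ‖v‖) := by ring
    _ ≤ ‖a‖ * ‖w‖ * G.normV v := by
        gcongr
        exact h v hv

lemma a_le_normW (hd : 0 < d) {v : L2Pair d} (hv : v ∈ P.V) (h0 : v ≠ 0) (w : L2Pair d) :
    P.a v w ≤ G.normV v * G.normW w := by
  rw [← div_le_iff₀' (normV_pos hd hv h0)]
  exact (isLUB_normW hd ⟨v, hv, h0⟩ w).1 ⟨v, hv, h0, rfl⟩

lemma normW_pos (hd : 0 < d) {w : L2Pair d} (hw : w ∈ P.V) (h0 : w ≠ 0) : 0 < G.normW w := by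
  obtain ⟨a, ha, γ, hγ, hco⟩ := P.exists_form_a hd
  have h1 : 0 < P.a w w := by
    rw [ha]
    exact (mul_pos hγ (pow_pos (norm_pos_iff.2 h0) 2)).trans_le (hco w hw)
  exact pos_of_mul_pos_right (h1.trans_le (a_le_normW hd hw h0 w)) (normV_pos hd hw h0).le

/-- The norm `‖·‖_W` of the Riesz representative of `v` is `‖v‖_V`. -/
lemma normW_eq_normV (hd : 0 < d) {v w : L2Pair d} (hv : v ∈ P.V) (h0 : v ≠ 0)
    (hw : ∀ u ∈ P.V, G.innerV u v = P.a u w) : G.normW w = G.normV v := by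
  -- The supremum is attained at `v` itself.
  refine (isLUB_normW hd ⟨v, hv, h0⟩ w).unique (IsGreatest.isLUB ⟨⟨v, hv, h0, ?_⟩, ?_⟩)
  · rw [← hw v hv, ← normV_sq, eq_div_iff (normV_pos hd hv h0).ne', pow_two]
  · rintro _ ⟨u, hu, hu0, rfl⟩
    rw [← hw u hu, div_le_iff₀' (normV_pos hd hu hu0)]
    exact innerV_le u v

lemma isLUB_stabQuotients (hd : 0 < d) (A : G.AuxBasis) (Q : G.TrialBasis) {v : L2Pair d}
    (hv : v ∈ Q.Vms) (h0 : v ≠ 0) : IsLUB (A.stabQuotients Q v) 1 := by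
  have hvV := Q.Vms_le hv
  have hpos := normV_pos (G := G) hd hvV h0
  obtain ⟨w, hw, e⟩ := exists_mem_Wglo hd A Q hv
  refine IsGreatest.isLUB ⟨⟨w, hw, ?_, ?_⟩, ?_⟩
  -- A zero representative would force `‖v‖_V² = a(v, 0) = 0`.
  · rintro rfl
    obtain ⟨a, ha, -⟩ := P.exists_form_a hd
    have h1 := e v hvV
    rw [ha, map_zero, ← normV_sq] at h1
    exact hpos.ne' (pow_eq_zero_iff two_ne_zero |>.1 h1)
  · rw [normW_eq_normV hd hvV h0 e, ← e v hvV, ← normV_sq, pow_two,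
      div_self (mul_pos hpos hpos).ne']
  · rintro _ ⟨z, hz, hz0, rfl⟩
    rw [div_le_one (mul_pos hpos (normW_pos hd (A.Wglo_le Q hz) hz0))]
    exact a_le_normW hd hvV h0 z

end CoarseGrid

end MultiscaleStab

/-- Every `v ∈ V_ms` has a unique `w ∈ W_glo` with `(u, v)_V = a(u, w)` for all `u ∈ V`; and if
`V_ms ≠ 0`, the infimum over nonzero `v ∈ V_ms` of the suprema over nonzero `z ∈ W_glo` of
`a(v, z) / (‖v‖_V ‖z‖_W)` is `1`. The suprema and the infimum that enter the claim (those that define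
`‖w‖_W` included) are asserted to be genuine least upper and greatest lower bounds. -/
theorem mainTheorem3 {d : ℕ} (hd : 0 < d) (P : MultiscaleStab.ConvectionDiffusion d)
    (G : MultiscaleStab.CoarseGrid P) (A : G.AuxBasis) (Q : G.TrialBasis) :
    (∀ v ∈ Q.Vms, ∃! w, w ∈ A.Wglo Q ∧ ∀ u ∈ P.V, G.innerV u v = P.a u w) ∧
    (Q.Vms ≠ ⊥ →
      (∀ w ∈ P.V, IsLUB (G.wQuotients w) (G.normW w)) ∧
      (∀ v ∈ Q.Vms, v ≠ 0 → IsLUB (A.stabQuotients Q v) (sSup (A.stabQuotients Q v))) ∧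
      IsGLB {t | ∃ v ∈ Q.Vms, v ≠ 0 ∧ t = sSup (A.stabQuotients Q v)} 1) := by
  refine ⟨fun v hv => ?_, fun hne => ?_⟩
  · obtain ⟨w, hw, e⟩ := MultiscaleStab.CoarseGrid.exists_mem_Wglo hd A Q hv
    refine ⟨w, ⟨hw, e⟩, fun w' ⟨hw', e'⟩ => ?_⟩
    obtain ⟨a, ha, -⟩ := P.exists_form_a hd
    have hV := P.V.sub_mem (A.Wglo_le Q hw') (A.Wglo_le Q hw)
    -- Both representatives give the same value when tested with their difference, which lies in
    -- `V`, where `a` is definite.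
    refine sub_eq_zero.1 (MultiscaleStab.CoarseGrid.eq_zero_of_a_self_eq_zero hd hV ?_)
    rw [ha, map_sub (a (w' - w)), ← ha, ← ha, ← e _ hV, ← e' _ hV, sub_self]
  · obtain ⟨v₀, hv₀, h0⟩ := Submodule.exists_mem_ne_zero_of_ne_bot hne
    have hsup : ∀ v ∈ Q.Vms, v ≠ 0 → IsLUB (A.stabQuotients Q v) 1 := fun v hv h =>
      MultiscaleStab.CoarseGrid.isLUB_stabQuotients hd A Q hv h
    have heq : ∀ v ∈ Q.Vms, v ≠ 0 → sSup (A.stabQuotients Q v) = 1 := fun v hv h =>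
      (hsup v hv h).csSup_eq (hsup v hv h).nonempty
    refine ⟨fun w _ => MultiscaleStab.CoarseGrid.isLUB_normW hd ⟨v₀, Q.Vms_le hv₀, h0⟩ w,
      fun v hv h => ?_, IsLeast.isGLB ⟨⟨v₀, hv₀, h0, (heq v₀ hv₀ h0).symm⟩, ?_⟩⟩
    · rw [heq v hv h]
      exact hsup v hv h
    · rintro _ ⟨v, hv, h, rfl⟩
      exact (heq v hv h).ge
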